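/- Let $A\in\mathbb{R}^{m\times n}$, let $\Delta_p=\{u\in\mathbb{R}^p : u\ge 0,\ \sum_i u_i=1\}$, and for $(x,y)\in\mathbb{R}^m\times\mathbb{R}^n$ put $$F(x,y)=\max\{x^{T}Av-u^{T}Ay : (u,v)\in\Delta_m\times\Delta_n\}.$$ Let $S=\{(x,y)\in\Delta_m\times\Delta_n : F(x,y)=0\}$ be the set of Nash equilibria of the matrix game, and let $$\kappa(A)=\inf\{\kappa\ge 0 : \operatorname{dist}((x,y);S)\le\kappa F(x,y)\ \text{for all}\ (x,y)\in\Delta_m\times\Delta_n\},$$ where all distances are Euclidean. Let $a_1,\dots,a_n\in\mathbb{R}^m$ be the columns of $A$, let $-b_1^{T},\dots,-b_m^{T}$ be its rows, let $e_1,\dots,e_{m+n}$ be the unit vectors of $\mathbb{R}^{m+n}$, and let $\mathbf 1_p=(1,\dots,1)\in\mathbb{R}^p$. For $(x,y)\in\Delta_m\times\Delta_n$ let $$I(x)=\{i : a_i^{T}x=\max_{i'}a_{i'}^{T}x\},\quad K(y)=\{k : b_k^{T}y=\max_{k'}b_{k'}^{T}y\},\quad J(x,y)=\{j\le m : x_j=0\}\cup\{m+p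 : y_p=0\},$$ $$G(x,y)=\operatorname{co}\{(a_i,b_k) : i\in I(x),\ k\in K(y)\}+\operatorname{span}\{\mathbf 1_m\}\times\operatorname{span}\{\mathbf 1_n\}-\operatorname{cone}\big[\operatorname{co}\{e_j : j\in J(x,y)\}\big],$$ where $\operatorname{co}$, $\operatorname{span}$ and $\operatorname{cone}$ are the convex, linear and conic hulls, and $\operatorname{cone}\emptyset=\{0\}$. Suppose that $(\Delta_m\times\Delta_n)\setminus S\ne\emptyset$. Then $\operatorname{dist}(0;G(x,y))>0$ for every $(x,y)\in(\Delta_m\times\Delta_n)\setminus S$, the set of constants $\kappa$ in the definition of $\kappa(A)$ is nonempty (so $\kappa(A)$ is finite), and $$\kappa(A)=\sup_{(x,y)\in(\Delta_m\times\Delta_n)\setminus S}\ \frac{1}{\operatorname{dist}\big(0;G(x,y)\big)}.$$ -/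

import Mathlib

open scoped Matrix Pointwise

noncomputable section

namespace MatrixGame

/-- The Euclidean space `ℝ^{m+n} = ℝ^m × ℝ^n`, with the Euclidean norm.  The coordinate
`Sum.inl k` is the `k`-th coordinate of `x`, and `Sum.inr p` is the `p`-th coordinate of `y`. -/
abbrev Space (m n : ℕ) : Type := EuclideanSpace ℝ (Fin m ⊕ Fin n)

variable {m n : ℕ}

/-- The vector `(x, y)` of `ℝ^{m+n}`. -/
def pair (x : Fin m → ℝ) (y : Fin n → ℝ) : Space m n := WithLp.toLp 2 (Sum.elim x y)

/-- The component `x` of `w = (x, y)`. -/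
def xPart (w : Space m n) : Fin m → ℝ := fun k => w (Sum.inl k)

/-- The component `y` of `w = (x, y)`. -/
def yPart (w : Space m n) : Fin n → ℝ := fun p => w (Sum.inr p)

/-- The product `Δ_m × Δ_n` of the standard simplices. -/
def simplexProd (m n : ℕ) : Set (Space m n) :=
  {w | xPart w ∈ stdSimplex ℝ (Fin m) ∧ yPart w ∈ stdSimplex ℝ (Fin n)}

/-- `F(x,y) = max {xᵀ A v - uᵀ A y : u ∈ Δ_m, v ∈ Δ_n}`. -/
def gap (A : Matrix (Fin m) (Fin n) ℝ) (w : Space m n) : ℝ :=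
  sSup {r : ℝ | ∃ u ∈ stdSimplex ℝ (Fin m), ∃ v ∈ stdSimplex ℝ (Fin n),
    r = xPart w ⬝ᵥ (A *ᵥ v) - u ⬝ᵥ (A *ᵥ yPart w)}

/-- The set `S` of Nash equilibria: the zeros of `F` in `Δ_m × Δ_n`. -/
def nashSet (A : Matrix (Fin m) (Fin n) ℝ) : Set (Space m n) :=
  {w | w ∈ simplexProd m n ∧ gap A w = 0}

/-- The condition measure
`κ(A) = inf {κ ≥ 0 : dist((x,y); S) ≤ κ F(x,y) for all (x,y) ∈ Δ_m × Δ_n}`. -/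
def conditionMeasure (A : Matrix (Fin m) (Fin n) ℝ) : ℝ :=
  sInf {κ : ℝ | 0 ≤ κ ∧ ∀ w ∈ simplexProd m n, Metric.infDist w (nashSet A) ≤ κ * gap A w}

/-- `a_i ∈ ℝ^m`, the `i`-th column of `A`. -/
def colVec (A : Matrix (Fin m) (Fin n) ℝ) (i : Fin n) : Fin m → ℝ := fun k => A k i

/-- `b_k ∈ ℝ^n`, minus the `k`-th row of `A`. -/
def negRowVec (A : Matrix (Fin m) (Fin n) ℝ) (k : Fin m) : Fin n → ℝ := fun i => -A k i

/-- `I(x)`: the indices `i` at which `a_iᵀ x` is maximal. -/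
def activeCols (A : Matrix (Fin m) (Fin n) ℝ) (x : Fin m → ℝ) : Set (Fin n) :=
  {i | ∀ i', colVec A i' ⬝ᵥ x ≤ colVec A i ⬝ᵥ x}

/-- `K(y)`: the indices `k` at which `b_kᵀ y` is maximal. -/
def activeRows (A : Matrix (Fin m) (Fin n) ℝ) (y : Fin n → ℝ) : Set (Fin m) :=
  {k | ∀ k', negRowVec A k' ⬝ᵥ y ≤ negRowVec A k ⬝ᵥ y}

/-- `J(x,y)`: the zero coordinates of `(x,y)`. -/
def zeroCoords (w : Space m n) : Set (Fin m ⊕ Fin n) := {j | w j = 0}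

/-- `span {1_m} × span {1_n}`. -/
def spanOnes (m n : ℕ) : Set (Space m n) :=
  {w | xPart w ∈ Submodule.span ℝ {(1 : Fin m → ℝ)} ∧
    yPart w ∈ Submodule.span ℝ {(1 : Fin n → ℝ)}}

/-- The set
`co {(a_i, b_k) : i ∈ I(x), k ∈ K(y)} + span {1_m} × span {1_n} - cone [co {e_j : j ∈ J(x,y)}]`.
`PointedCone.hull` is the set of all nonnegative linear combinations, so it is `{0}` when
`J(x,y)` is empty. -/
def dataSet (A : Matrix (Fin m) (Fin n) ℝ) (w : Space m n) : Set (Space m n) :=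
  convexHull ℝ {v : Space m n | ∃ i ∈ activeCols A (xPart w), ∃ k ∈ activeRows A (yPart w),
      v = pair (colVec A i) (negRowVec A k)}
    + spanOnes m n
    - (PointedCone.hull ℝ (convexHull ℝ
        {v : Space m n | ∃ j ∈ zeroCoords w, v = EuclideanSpace.single j (1 : ℝ)}) :
        Set (Space m n))

end MatrixGame

end

/-!
`F` is the maximum of the finitely many linear functionals `⟪(a_i, b_k), ·⟫`, and `G(w)` is the
sum of its subdifferential at `w` and of the normal cone to `Δ_m × Δ_n` at `w`. The theorem says
that the best global error bound constant of a convex function is the supremum of the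
reciprocals of its slopes off the solution set, the slope at `w` being `dist(0; G(w))`.

A valid `κ` bounds the reciprocals: the subgradient inequality for `g ∈ G(w)` gives
`F(w) ≤ ‖g‖ dist(w; S)` (`gap_sub_gap_le_of_mem_dataSet`, `inv_infDist_dataSet_le`).
Conversely, suppose `κ` bounds the reciprocals and `dist(w₀; S) > κ F(w₀)`. A minimizer `w` of
`F + c ‖· - w₀‖` with `c` slightly below `1 / κ` is not in `S`, and its slope is at most `c`:
otherwise `F` would decrease too fast along minus the projection of `0` onto the closure of
`G(w)` (`exists_descent_direction`, `exists_infDist_dataSet_le`, `infDist_nashSet_le`).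

That slopes are positive off `S` is linear programming duality. The convex combinations of the
`(a_i, b_k)` are the vectors `L(u, v)` with `(u, v) ∈ Δ_m × Δ_n` and `L(u, v) = (A v, -Aᵀ u)`
skew-symmetric. Hence `⟪g, w - (u, v)⟫ ≥ F(w)` when `L(u, v)` is the subgradient part of
`g ∈ G(w)`, and `F(w) ≤ 4 ‖g‖` (`gap_le_of_mem_dataSet`). With `c = 0` the minimization above
then yields the minimax theorem `nashSet_nonempty`, and no closedness of `G(w)` is needed.
Finally the supremum is finite since `G(w)` takes finitely many values.
-/

open Filter Topology

namespace MatrixGame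

variable {m n : ℕ}

theorem inner_pair (x : Fin m → ℝ) (y : Fin n → ℝ) (w : Space m n) :
    inner ℝ (pair x y) w = x ⬝ᵥ xPart w + y ⬝ᵥ yPart w := by
  simp [PiLp.inner_apply, pair, xPart, yPart, dotProduct, mul_comm]

theorem pair_parts (w : Space m n) : pair (xPart w) (yPart w) = w := by
  ext j; rcases j with j | j <;> rfl

theorem isLinearMap_inner_left (z : Space m n) :
    IsLinearMap ℝ fun q : Space m n => inner ℝ q z :=
  ⟨fun a b => inner_add_left a b z, fun c a => by simp [real_inner_smul_left]⟩

/-! ### The strategy space -/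

theorem convex_simplexProd : Convex ℝ (simplexProd m n) := by
  intro w hw z hz a b ha hb hab
  exact ⟨convex_stdSimplex ℝ (Fin m) hw.1 hz.1 ha hb hab,
    convex_stdSimplex ℝ (Fin n) hw.2 hz.2 ha hb hab⟩

theorem nonneg_of_mem_simplexProd {w : Space m n} (hw : w ∈ simplexProd m n)
    (j : Fin m ⊕ Fin n) : 0 ≤ w j := by
  rcases j with j | j
  · exact hw.1.1 j
  · exact hw.2.1 j

theorem norm_le_two_of_mem_simplexProd {w : Space m n} (hw : w ∈ simplexProd m n) :
    ‖w‖ ≤ 2 := by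
  have key : ∀ {k : ℕ} {f : Fin k → ℝ}, f ∈ stdSimplex ℝ (Fin k) → ∑ i, f i ^ 2 ≤ 1 := by
    intro k f hf
    rw [← hf.2]
    refine Finset.sum_le_sum fun i _ => ?_
    have h1 : f i ≤ 1 := (mem_Icc_of_mem_stdSimplex hf i).2
    nlinarith [hf.1 i]
  have hx := key hw.1
  have hy := key hw.2
  have h : ‖w‖ ^ 2 ≤ 2 := by
    rw [EuclideanSpace.real_norm_sq_eq, Fintype.sum_sum_type]
    exact (add_le_add hx hy).trans (by norm_num)
  nlinarith [norm_nonneg w]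

theorem isCompact_simplexProd : IsCompact (simplexProd m n) := by
  refine Metric.isCompact_of_isClosed_isBounded ?_ ?_
  · have hx : Continuous (xPart : Space m n → Fin m → ℝ) := by unfold xPart; fun_prop
    have hy : Continuous (yPart : Space m n → Fin n → ℝ) := by unfold yPart; fun_prop
    exact ((isClosed_stdSimplex ℝ (Fin m)).preimage hx).inter
      ((isClosed_stdSimplex ℝ (Fin n)).preimage hy)
  · refine Metric.isBounded_closedBall (x := (0 : Space m n)) (r := 2) |>.subset fun w hw => ?_
    simpa using norm_le_two_of_mem_simplexProd hw

/-! ### The gap as a maximum of finitely many linear functionals -/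

/-- The linear functional `⟪(a_i, b_k), ·⟫` is a piece of the polyhedral function `F`. -/
def pieceVec (A : Matrix (Fin m) (Fin n) ℝ) (i : Fin n) (k : Fin m) : Space m n :=
  pair (colVec A i) (negRowVec A k)

theorem inner_pieceVec (A : Matrix (Fin m) (Fin n) ℝ) (i : Fin n) (k : Fin m) (w : Space m n) :
    inner ℝ (pieceVec A i k) w = colVec A i ⬝ᵥ xPart w + negRowVec A k ⬝ᵥ yPart w :=
  inner_pair _ _ _

theorem activeCols_nonempty [NeZero n] (A : Matrix (Fin m) (Fin n) ℝ) (x : Fin m → ℝ) :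
    (activeCols A x).Nonempty :=
  Finite.exists_max fun i => colVec A i ⬝ᵥ x

theorem activeRows_nonempty [NeZero m] (A : Matrix (Fin m) (Fin n) ℝ) (y : Fin n → ℝ) :
    (activeRows A y).Nonempty :=
  Finite.exists_max fun k => negRowVec A k ⬝ᵥ y

theorem dotProduct_le_of_mem_stdSimplex {k : ℕ} {f g : Fin k → ℝ} {c : ℝ}
    (hf : f ∈ stdSimplex ℝ (Fin k)) (hg : ∀ i, g i ≤ c) : f ⬝ᵥ g ≤ c := by
  calc f ⬝ᵥ g ≤ ∑ i, f i * c :=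
        Finset.sum_le_sum fun i _ => mul_le_mul_of_nonneg_left (hg i) (hf.1 i)
    _ = c := by rw [← Finset.sum_mul, hf.2, one_mul]

/-- The maximum defining `F` is attained at a pair of pure strategies, one for each player. -/
theorem isGreatest_inner_pieceVec {A : Matrix (Fin m) (Fin n) ℝ} {w : Space m n} {i : Fin n}
    {k : Fin m} (hi : i ∈ activeCols A (xPart w)) (hk : k ∈ activeRows A (yPart w)) :
    IsGreatest {r : ℝ | ∃ u ∈ stdSimplex ℝ (Fin m), ∃ v ∈ stdSimplex ℝ (Fin n),
      r = xPart w ⬝ᵥ (A *ᵥ v) - u ⬝ᵥ (A *ᵥ yPart w)} (inner ℝ (pieceVec A i k) w) := by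
  rw [inner_pieceVec]
  refine ⟨⟨Pi.single k 1, single_mem_stdSimplex ℝ k, Pi.single i 1,
    single_mem_stdSimplex ℝ i, ?_⟩, ?_⟩
  · rw [Matrix.mulVec_single_one, single_one_dotProduct, sub_eq_add_neg]
    congr 1
    · rw [dotProduct_comm]; rfl
    · simp [negRowVec, Matrix.mulVec, dotProduct]
  · rintro r ⟨u, hu, v, hv, rfl⟩
    rw [sub_eq_add_neg]
    refine add_le_add ?_ ?_
    · rw [Matrix.dotProduct_mulVec, dotProduct_comm]
      refine dotProduct_le_of_mem_stdSimplex hv fun i' => ?_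
      have h := hi i'
      rwa [dotProduct_comm (colVec A i')] at h
    · rw [← dotProduct_neg]
      refine dotProduct_le_of_mem_stdSimplex hu fun k' => ?_
      have h := hk k'
      refine le_of_eq_of_le ?_ h
      simp [negRowVec, Matrix.mulVec, dotProduct]

theorem gap_eq_of_active {A : Matrix (Fin m) (Fin n) ℝ} {w : Space m n} {i : Fin n} {k : Fin m}
    (hi : i ∈ activeCols A (xPart w)) (hk : k ∈ activeRows A (yPart w)) :
    gap A w = inner ℝ (pieceVec A i k) w :=
  (isGreatest_inner_pieceVec hi hk).csSup_eq

section Nonempty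

variable [NeZero m] [NeZero n]

theorem inner_pieceVec_le_gap (A : Matrix (Fin m) (Fin n) ℝ) (i : Fin n) (k : Fin m)
    (w : Space m n) : inner ℝ (pieceVec A i k) w ≤ gap A w := by
  obtain ⟨i', hi'⟩ := activeCols_nonempty A (xPart w)
  obtain ⟨k', hk'⟩ := activeRows_nonempty A (yPart w)
  rw [gap_eq_of_active hi' hk', inner_pieceVec, inner_pieceVec]
  exact add_le_add (hi' i) (hk' k)

theorem active_of_inner_pieceVec_eq_gap {A : Matrix (Fin m) (Fin n) ℝ} {i : Fin n} {k : Fin m}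
    {w : Space m n} (h : inner ℝ (pieceVec A i k) w = gap A w) :
    i ∈ activeCols A (xPart w) ∧ k ∈ activeRows A (yPart w) := by
  constructor
  · intro i'
    have h' := inner_pieceVec_le_gap A i' k w
    rw [← h, inner_pieceVec, inner_pieceVec] at h'
    exact le_of_add_le_add_right h'
  · intro k'
    have h' := inner_pieceVec_le_gap A i k' w
    rw [← h, inner_pieceVec, inner_pieceVec] at h'
    exact le_of_add_le_add_left h'

theorem gap_eq_sup' (A : Matrix (Fin m) (Fin n) ℝ) (w : Space m n) :
    gap A w = (Finset.univ : Finset (Fin n × Fin m)).sup' Finset.univ_nonempty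
      (fun p => inner ℝ (pieceVec A p.1 p.2) w) := by
  obtain ⟨i, hi⟩ := activeCols_nonempty A (xPart w)
  obtain ⟨k, hk⟩ := activeRows_nonempty A (yPart w)
  apply le_antisymm
  · rw [gap_eq_of_active hi hk]
    exact Finset.le_sup' (fun p : Fin n × Fin m => inner ℝ (pieceVec A p.1 p.2) w)
      (Finset.mem_univ (i, k))
  · exact Finset.sup'_le _ _ fun p _ => inner_pieceVec_le_gap A p.1 p.2 w

theorem gap_le_iff {A : Matrix (Fin m) (Fin n) ℝ} {w : Space m n} {c : ℝ} :
    gap A w ≤ c ↔ ∀ i k, inner ℝ (pieceVec A i k) w ≤ c := by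
  simp [gap_eq_sup', Prod.forall]

theorem continuous_gap (A : Matrix (Fin m) (Fin n) ℝ) : Continuous (gap A) := by
  rw [funext (gap_eq_sup' A)]
  exact Continuous.finset_sup'_apply _ fun p _ => by fun_prop

theorem gap_nonneg (A : Matrix (Fin m) (Fin n) ℝ) {w : Space m n} (hw : w ∈ simplexProd m n) :
    0 ≤ gap A w := by
  obtain ⟨i, hi⟩ := activeCols_nonempty A (xPart w)
  obtain ⟨k, hk⟩ := activeRows_nonempty A (yPart w)
  rw [gap_eq_of_active hi hk]
  exact (isGreatest_inner_pieceVec hi hk).2 ⟨_, hw.1, _, hw.2, (sub_self _).symm⟩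

end Nonempty

/-! ### The skew-symmetric operator of the game -/

/-- The skew-symmetric operator `(u, v) ↦ (A v, -Aᵀ u)`. -/
def skewMap (A : Matrix (Fin m) (Fin n) ℝ) : Space m n →ₗ[ℝ] Space m n where
  toFun z := pair (A *ᵥ yPart z) (-(xPart z ᵥ* A))
  map_add' z z' := by
    rw [show xPart (z + z') = xPart z + xPart z' from rfl,
      show yPart (z + z') = yPart z + yPart z' from rfl, Matrix.mulVec_add, Matrix.add_vecMul]
    ext j; rcases j with j | j <;> simp [pair]; ring
  map_smul' c z := by
    rw [show xPart (c • z) = c • xPart z from rfl,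
      show yPart (c • z) = c • yPart z from rfl, Matrix.mulVec_smul, Matrix.smul_vecMul]
    ext j; rcases j with j | j <;> simp [pair]

theorem inner_skewMap_self (A : Matrix (Fin m) (Fin n) ℝ) (z : Space m n) :
    inner ℝ (skewMap A z) z = 0 := by
  change inner ℝ (pair (A *ᵥ yPart z) (-(xPart z ᵥ* A))) z = 0
  rw [inner_pair, neg_dotProduct, ← Matrix.dotProduct_mulVec, dotProduct_comm, add_neg_cancel]

theorem pieceVec_mem_image_skewMap (A : Matrix (Fin m) (Fin n) ℝ) (i : Fin n) (k : Fin m) :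
    pieceVec A i k ∈ skewMap A '' simplexProd m n := by
  refine ⟨pair (Pi.single k 1) (Pi.single i 1),
    ⟨single_mem_stdSimplex ℝ k, single_mem_stdSimplex ℝ i⟩, ?_⟩
  change pair (A *ᵥ Pi.single i 1) (-(Pi.single k 1 ᵥ* A)) = _
  rw [Matrix.mulVec_single_one, Matrix.single_one_vecMul]
  rfl

/-! ### The summands of the data set -/

theorem inner_eq_of_mem_spanOnes {s : Space m n} (hs : s ∈ spanOnes m n) :
    ∃ α β : ℝ, ∀ w, inner ℝ s w = α * ∑ i, xPart w i + β * ∑ i, yPart w i := by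
  obtain ⟨α, hα⟩ := Submodule.mem_span_singleton.1 hs.1
  obtain ⟨β, hβ⟩ := Submodule.mem_span_singleton.1 hs.2
  refine ⟨α, β, fun w => ?_⟩
  rw [← pair_parts s, inner_pair, ← hα, ← hβ, smul_dotProduct, smul_dotProduct,
    one_dotProduct, one_dotProduct, smul_eq_mul, smul_eq_mul]

theorem pair_mem_spanOnes (α β : ℝ) :
    pair (α • (1 : Fin m → ℝ)) (β • (1 : Fin n → ℝ)) ∈ spanOnes m n :=
  ⟨Submodule.mem_span_singleton.2 ⟨α, rfl⟩, Submodule.mem_span_singleton.2 ⟨β, rfl⟩⟩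

theorem inner_pair_ones (α β : ℝ) (w : Space m n) :
    inner ℝ (pair (α • (1 : Fin m → ℝ)) (β • (1 : Fin n → ℝ))) w =
      α * ∑ i, xPart w i + β * ∑ i, yPart w i := by
  rw [inner_pair, smul_dotProduct, smul_dotProduct, one_dotProduct, one_dotProduct,
    smul_eq_mul, smul_eq_mul]

theorem zero_mem_spanOnes : (0 : Space m n) ∈ spanOnes m n :=
  ⟨Submodule.zero_mem _, Submodule.zero_mem _⟩

theorem convex_spanOnes : Convex ℝ (spanOnes m n) := fun _ hw _ hz _ _ _ _ _ =>
  ⟨Submodule.add_mem _ (Submodule.smul_mem _ _ hw.1) (Submodule.smul_mem _ _ hz.1),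
    Submodule.add_mem _ (Submodule.smul_mem _ _ hw.2) (Submodule.smul_mem _ _ hz.2)⟩

/-- The convex hull of the active pieces: the subdifferential of `F` at `w`. -/
def activeHull (A : Matrix (Fin m) (Fin n) ℝ) (w : Space m n) : Set (Space m n) :=
  convexHull ℝ {v : Space m n | ∃ i ∈ activeCols A (xPart w), ∃ k ∈ activeRows A (yPart w),
      v = pair (colVec A i) (negRowVec A k)}

/-- The cone spanned by the unit vectors at the zero coordinates of `w`. -/
def zeroCone (w : Space m n) : PointedCone ℝ (Space m n) :=
  PointedCone.hull ℝ (convexHull ℝ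
    {v : Space m n | ∃ j ∈ zeroCoords w, v = EuclideanSpace.single j (1 : ℝ)})

theorem dataSet_eq (A : Matrix (Fin m) (Fin n) ℝ) (w : Space m n) :
    dataSet A w = activeHull A w + spanOnes m n - (zeroCone w : Set (Space m n)) := rfl

theorem pieceVec_mem_activeHull {A : Matrix (Fin m) (Fin n) ℝ} {w : Space m n} {i : Fin n}
    {k : Fin m} (hi : i ∈ activeCols A (xPart w)) (hk : k ∈ activeRows A (yPart w)) :
    pieceVec A i k ∈ activeHull A w :=
  subset_convexHull ℝ _ ⟨i, hi, k, hk, rfl⟩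

theorem single_mem_zeroCone {w : Space m n} {j : Fin m ⊕ Fin n} (hj : w j = 0) :
    EuclideanSpace.single j (1 : ℝ) ∈ zeroCone w :=
  PointedCone.subset_hull (subset_convexHull ℝ _ ⟨j, hj, rfl⟩)

theorem inner_of_mem_zeroCone {w p : Space m n} (hp : p ∈ zeroCone w) :
    inner ℝ p w = 0 ∧ ∀ z ∈ simplexProd m n, 0 ≤ inner ℝ p z := by
  refine Submodule.span_induction (p := fun p _ =>
    inner ℝ p w = 0 ∧ ∀ z ∈ simplexProd m n, 0 ≤ inner ℝ p z) ?_ ?_ ?_ ?_ hp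
  · intro q hq
    have hq' : q ∈ ({q : Space m n | inner ℝ q w = 0} ∩
        ⋂ z ∈ simplexProd m n, {q : Space m n | 0 ≤ inner ℝ q z}) := by
      refine convexHull_min ?_ ?_ hq
      · rintro _ ⟨j, hj, rfl⟩
        have hj' : w j = 0 := hj
        refine ⟨by simp [EuclideanSpace.inner_single_left, hj'], ?_⟩
        simp only [Set.mem_iInter, Set.mem_ofPred_eq, EuclideanSpace.inner_single_left, map_one,
          one_mul]
        exact fun z hz => nonneg_of_mem_simplexProd hz j
      · exact (convex_hyperplane (isLinearMap_inner_left w) 0).inter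
          (convex_iInter₂ fun z _ => convex_halfSpace_ge (isLinearMap_inner_left z) 0)
    simpa using hq'
  · simp
  · rintro a b - - ⟨ha, ha'⟩ ⟨hb, hb'⟩
    refine ⟨by rw [inner_add_left, ha, hb, add_zero], fun z hz => ?_⟩
    rw [inner_add_left]
    exact add_nonneg (ha' z hz) (hb' z hz)
  · rintro c a - ⟨ha, ha'⟩
    have hc : ∀ z : Space m n, inner ℝ (c • a) z = (c : ℝ) * inner ℝ a z := fun z =>
      real_inner_smul_left a z c
    exact ⟨by rw [hc, ha, mul_zero], fun z hz => by
      rw [hc]; exact mul_nonneg c.2 (ha' z hz)⟩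

theorem convex_dataSet (A : Matrix (Fin m) (Fin n) ℝ) (w : Space m n) :
    Convex ℝ (dataSet A w) :=
  ((convex_convexHull ℝ _).add convex_spanOnes).sub (PointedCone.convex _)

section Nonempty

variable [NeZero m] [NeZero n]

theorem dataSet_nonempty (A : Matrix (Fin m) (Fin n) ℝ) (w : Space m n) :
    (dataSet A w).Nonempty := by
  obtain ⟨i, hi⟩ := activeCols_nonempty A (xPart w)
  obtain ⟨k, hk⟩ := activeRows_nonempty A (yPart w)
  exact ⟨_, Set.sub_mem_sub (Set.add_mem_add (pieceVec_mem_activeHull hi hk) zero_mem_spanOnes)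
    (zeroCone w).zero_mem⟩

/-- An active convex combination `h` is a subgradient of `F` at `w`, and it has the form
`(A v, -Aᵀ u)`. -/
theorem inner_of_mem_activeHull {A : Matrix (Fin m) (Fin n) ℝ} {w h : Space m n}
    (hh : h ∈ activeHull A w) :
    inner ℝ h w = gap A w ∧ (∀ z, inner ℝ h z ≤ gap A z) ∧
      h ∈ skewMap A '' simplexProd m n := by
  refine ⟨convexHull_min ?_ (convex_hyperplane (isLinearMap_inner_left w) (gap A w)) hh,
    fun z => convexHull_min ?_ (convex_halfSpace_le (isLinearMap_inner_left z) (gap A z)) hh,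
    convexHull_min ?_ (convex_simplexProd.linear_image _) hh⟩
  · rintro _ ⟨i, hi, k, hk, rfl⟩
    exact (gap_eq_of_active hi hk).symm
  · rintro _ ⟨i, hi, k, hk, rfl⟩
    exact inner_pieceVec_le_gap A i k z
  · rintro _ ⟨i, hi, k, hk, rfl⟩
    exact pieceVec_mem_image_skewMap A i k

/-! ### Lower bounds for the norm of the elements of the data set -/

/-- Elements of `G(w)` differ from a subgradient `h` of `F` by a normal vector to
`Δ_m × Δ_n`. -/
theorem exists_activeHull_of_mem_dataSet {A : Matrix (Fin m) (Fin n) ℝ} {w g : Space m n}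
    (hw : w ∈ simplexProd m n) (hg : g ∈ dataSet A w) :
    ∃ h ∈ activeHull A w, ∀ z ∈ simplexProd m n,
      gap A w - inner ℝ h z ≤ inner ℝ g (w - z) := by
  rw [dataSet_eq] at hg
  obtain ⟨_, ⟨h, hh, s, hs, rfl⟩, p, hp, rfl⟩ := hg
  refine ⟨h, hh, fun z hz => ?_⟩
  obtain ⟨α, β, hαβ⟩ := inner_eq_of_mem_spanOnes hs
  have hsw := hαβ w
  have hsz := hαβ z
  rw [hw.1.2, hw.2.2] at hsw
  rw [hz.1.2, hz.2.2] at hsz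
  have hpz := (inner_of_mem_zeroCone hp).2 z hz
  simp only [inner_sub_left, inner_add_left, inner_sub_right, hsw, hsz,
    (inner_of_mem_zeroCone hp).1, (inner_of_mem_activeHull hh).1]
  linarith

theorem gap_sub_gap_le_of_mem_dataSet {A : Matrix (Fin m) (Fin n) ℝ} {w g z : Space m n}
    (hw : w ∈ simplexProd m n) (hg : g ∈ dataSet A w) (hz : z ∈ simplexProd m n) :
    gap A w - gap A z ≤ ‖g‖ * dist w z := by
  obtain ⟨h, hh, hhz⟩ := exists_activeHull_of_mem_dataSet hw hg
  rw [dist_eq_norm]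
  linarith [hhz z hz, (inner_of_mem_activeHull hh).2.1 z, real_inner_le_norm g (w - z)]

/-- Linear programming duality in quantitative form. The subgradient `h = (A v, -Aᵀ u)` is
orthogonal to `(u, v)` by skew symmetry, so comparing `w` with `(u, v)` leaves `F(w)` alone. -/
theorem gap_le_of_mem_dataSet {A : Matrix (Fin m) (Fin n) ℝ} {w g : Space m n}
    (hw : w ∈ simplexProd m n) (hg : g ∈ dataSet A w) : gap A w ≤ 4 * ‖g‖ := by
  obtain ⟨h, hh, hhz⟩ := exists_activeHull_of_mem_dataSet hw hg
  obtain ⟨z, hz, rfl⟩ := (inner_of_mem_activeHull hh).2.2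
  have h1 := hhz z hz
  rw [inner_skewMap_self, sub_zero] at h1
  have h2 : ‖w - z‖ ≤ 4 := by
    linarith [norm_sub_le w z, norm_le_two_of_mem_simplexProd hw,
      norm_le_two_of_mem_simplexProd hz]
  nlinarith [real_inner_le_norm g (w - z), norm_nonneg g]

theorem gap_le_infDist_dataSet {A : Matrix (Fin m) (Fin n) ℝ} {w : Space m n}
    (hw : w ∈ simplexProd m n) : gap A w ≤ 4 * Metric.infDist 0 (dataSet A w) := by
  have h : gap A w / 4 ≤ Metric.infDist 0 (dataSet A w) := by
    refine (Metric.le_infDist (dataSet_nonempty A w)).2 fun g hg => ?_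
    rw [dist_zero_left]
    linarith [gap_le_of_mem_dataSet hw hg]
  linarith

theorem gap_pos {A : Matrix (Fin m) (Fin n) ℝ} {w : Space m n}
    (hw : w ∈ simplexProd m n \ nashSet A) : 0 < gap A w :=
  (gap_nonneg A hw.1).lt_of_ne fun h => hw.2 ⟨hw.1, h.symm⟩

theorem infDist_dataSet_pos {A : Matrix (Fin m) (Fin n) ℝ} {w : Space m n}
    (hw : w ∈ simplexProd m n \ nashSet A) : 0 < Metric.infDist 0 (dataSet A w) := by
  linarith [gap_pos hw, gap_le_infDist_dataSet (A := A) hw.1]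

end Nonempty

/-! ### Descent directions -/

theorem exists_norm_eq_infDist_zero {E : Type*} [NormedAddCommGroup E] [InnerProductSpace ℝ E]
    [ProperSpace E] {K : Set E} (hne : K.Nonempty) (hK : Convex ℝ K) :
    ∃ v, ‖v‖ = Metric.infDist 0 K ∧ ∀ g ∈ K, ‖v‖ ^ 2 ≤ inner ℝ g v := by
  obtain ⟨v, hv, hd⟩ := isClosed_closure.exists_infDist_eq_dist hne.closure (0 : E)
  rw [Metric.infDist_closure, dist_zero_left] at hd
  refine ⟨v, hd.symm, fun g hg => ?_⟩
  have h : ‖0 - v‖ = ⨅ w : closure K, ‖0 - (w : E)‖ := by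
    simp_rw [← dist_eq_norm]
    rw [← Metric.infDist_eq_iInf, Metric.infDist_closure, hd, dist_zero_left]
  have h1 := (norm_eq_iInf_iff_real_inner_le_zero hK.closure hv).1 h g (subset_closure hg)
  rw [zero_sub, inner_neg_left, inner_sub_right, real_inner_self_eq_norm_sq,
    real_inner_comm] at h1
  linarith

theorem nonpos_of_forall_mul_le {a b : ℝ} (h : ∀ t : ℝ, 0 ≤ t → t * a ≤ b) : a ≤ 0 := by
  by_contra! ha
  have h0 := h ((|b| + 1) / a) (by positivity)
  rw [div_mul_cancel₀ _ ha.ne'] at h0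
  linarith [le_abs_self b]

theorem eventually_nonneg_add_mul {a b : ℝ} (ha : 0 ≤ a) (h : a = 0 → 0 ≤ b) :
    ∀ᶠ t in 𝓝[>] (0 : ℝ), 0 ≤ a + t * b := by
  rcases ha.eq_or_lt with ha | ha
  · filter_upwards [self_mem_nhdsWithin] with t ht
    have := mul_nonneg (le_of_lt ht) (h ha.symm)
    linarith
  · have hc : Tendsto (fun t : ℝ => a + t * b) (𝓝[>] 0) (𝓝 a) := by
      have : Continuous fun t : ℝ => a + t * b := by fun_prop
      simpa using (this.tendsto 0).mono_left nhdsWithin_le_nhds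
    exact (hc.eventually (lt_mem_nhds ha)).mono fun _ => le_of_lt

section Nonempty

variable [NeZero m] [NeZero n]

/-- Steepest descent: moving from `w` along `d`, minus the projection of `0` onto the closure
of `G(w)`, stays in `Δ_m × Δ_n` and decreases `F` at the rate `dist(0; G(w)) ^ 2 = ‖d‖ ^ 2`. -/
theorem exists_descent_direction (A : Matrix (Fin m) (Fin n) ℝ) {w : Space m n}
    (hw : w ∈ simplexProd m n) :
    ∃ d : Space m n, ‖d‖ = Metric.infDist 0 (dataSet A w) ∧
      ∀ᶠ t in 𝓝[>] (0 : ℝ), w + t • d ∈ simplexProd m n ∧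
        gap A (w + t • d) ≤ gap A w - t * ‖d‖ ^ 2 := by
  obtain ⟨v, hv, hvG⟩ := exists_norm_eq_infDist_zero (dataSet_nonempty A w) (convex_dataSet A w)
  have hmain : ∀ h ∈ activeHull A w, ∀ s ∈ spanOnes m n, ∀ p ∈ zeroCone w,
      ‖v‖ ^ 2 ≤ inner ℝ h v + inner ℝ s v - inner ℝ p v := fun h hh s hs p hp => by
    rw [← inner_add_left, ← inner_sub_left]
    exact hvG _ (Set.sub_mem_sub (Set.add_mem_add hh hs) hp)
  obtain ⟨i₀, hi₀⟩ := activeCols_nonempty A (xPart w)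
  obtain ⟨k₀, hk₀⟩ := activeRows_nonempty A (yPart w)
  have h₀ := pieceVec_mem_activeHull hi₀ hk₀
  have hones : ∀ α β : ℝ, α * ∑ i, xPart v i + β * ∑ i, yPart v i = 0 := by
    have hle : ∀ α β : ℝ, -(α * ∑ i, xPart v i + β * ∑ i, yPart v i) ≤ 0 := by
      refine fun α β => nonpos_of_forall_mul_le
        (b := inner ℝ (pieceVec A i₀ k₀) v - ‖v‖ ^ 2) fun t _ => ?_
      have h := hmain _ h₀ _ (pair_mem_spanOnes (t * α) (t * β)) 0 (zeroCone w).zero_mem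
      rw [inner_pair_ones, inner_zero_left] at h
      linarith
    intro α β
    linarith [hle α β, hle (-α) (-β)]
  have hx : ∑ i, xPart v i = 0 := by simpa using hones 1 0
  have hy : ∑ i, yPart v i = 0 := by simpa using hones 0 1
  have hcoord : ∀ j, w j = 0 → v j ≤ 0 := by
    refine fun j hj => nonpos_of_forall_mul_le
      (b := inner ℝ (pieceVec A i₀ k₀) v - ‖v‖ ^ 2) fun t ht => ?_
    have h := hmain _ h₀ 0 zero_mem_spanOnes _
      ((zeroCone w).smul_mem ht (single_mem_zeroCone hj))
    rw [real_inner_smul_left, EuclideanSpace.inner_single_left, map_one, one_mul,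
      inner_zero_left] at h
    linarith
  refine ⟨-v, by rw [norm_neg, hv], ?_⟩
  have hev1 : ∀ᶠ t in 𝓝[>] (0 : ℝ), ∀ j, 0 ≤ w j + t * (-v j) :=
    eventually_all.2 fun j => eventually_nonneg_add_mul (nonneg_of_mem_simplexProd hw j)
      fun hj => neg_nonneg.2 (hcoord j hj)
  -- An inactive piece lies strictly below `F(w)`, so only the active ones matter for small `t`.
  have hev2 : ∀ᶠ t in 𝓝[>] (0 : ℝ), ∀ i k,
      0 ≤ (gap A w - inner ℝ (pieceVec A i k) w) +
        t * (inner ℝ (pieceVec A i k) v - ‖v‖ ^ 2) := by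
    refine eventually_all.2 fun i => eventually_all.2 fun k => eventually_nonneg_add_mul
      (sub_nonneg.2 (inner_pieceVec_le_gap A i k w)) fun h => ?_
    obtain ⟨hi, hk⟩ := active_of_inner_pieceVec_eq_gap (sub_eq_zero.1 h).symm
    have := hmain _ (pieceVec_mem_activeHull hi hk) 0 zero_mem_spanOnes 0 (zeroCone w).zero_mem
    rw [inner_zero_left] at this
    linarith
  filter_upwards [hev1, hev2] with t h1 h2
  refine ⟨⟨⟨fun j => h1 (Sum.inl j), ?_⟩, ⟨fun j => h1 (Sum.inr j), ?_⟩⟩,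
    gap_le_iff.2 fun i k => ?_⟩
  · change ∑ j, (xPart w j + t * -xPart v j) = 1
    rw [Finset.sum_add_distrib, ← Finset.mul_sum, Finset.sum_neg_distrib, hx, hw.1.2]
    simp
  · change ∑ j, (yPart w j + t * -yPart v j) = 1
    rw [Finset.sum_add_distrib, ← Finset.mul_sum, Finset.sum_neg_distrib, hy, hw.2.2]
    simp
  · rw [inner_add_right, real_inner_smul_right, inner_neg_right, norm_neg]
    linarith [h2 i k]

/-- The witness is a minimizer of `F + c ‖· - w₀‖` on `Δ_m × Δ_n`: a slope of `F` above `c` there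
would let `F` decrease faster than the penalty grows. -/
theorem exists_infDist_dataSet_le (A : Matrix (Fin m) (Fin n) ℝ) {w₀ : Space m n}
    (hw₀ : w₀ ∈ simplexProd m n) {c : ℝ} (hc : 0 ≤ c) :
    ∃ w ∈ simplexProd m n, gap A w + c * dist w w₀ ≤ gap A w₀ ∧
      Metric.infDist 0 (dataSet A w) ≤ c := by
  have hcont : Continuous fun w => gap A w + c * dist w w₀ := by
    have := continuous_gap A
    fun_prop
  obtain ⟨w, hw, hmin⟩ := isCompact_simplexProd.exists_isMinOn ⟨w₀, hw₀⟩ hcont.continuousOn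
  refine ⟨w, hw, by simpa using hmin hw₀, ?_⟩
  by_contra! hlt
  obtain ⟨d, hd, hev⟩ := exists_descent_direction A hw
  rw [← hd] at hlt
  obtain ⟨t, ⟨hmem, hgap⟩, ht⟩ := (hev.and self_mem_nhdsWithin).exists
  have ht : 0 < t := ht
  have h1 : gap A w + c * dist w w₀ ≤ gap A (w + t • d) + c * dist (w + t • d) w₀ := hmin hmem
  have h2 : dist (w + t • d) w₀ ≤ dist w w₀ + t * ‖d‖ := by
    refine (dist_triangle (w + t • d) w w₀).trans ?_
    rw [dist_eq_norm, add_sub_cancel_left, norm_smul, Real.norm_of_nonneg ht.le, add_comm]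
  have h3 : 0 < t * (‖d‖ * (‖d‖ - c)) :=
    mul_pos ht (mul_pos (hc.trans_lt hlt) (sub_pos.2 hlt))
  nlinarith [mul_le_mul_of_nonneg_left h2 hc]

/-- The minimax theorem. -/
theorem nashSet_nonempty (A : Matrix (Fin m) (Fin n) ℝ) : (nashSet A).Nonempty := by
  obtain ⟨w, hw, -, hG⟩ := exists_infDist_dataSet_le A
    (w₀ := pair (Pi.single 0 1) (Pi.single 0 1))
    ⟨single_mem_stdSimplex ℝ 0, single_mem_stdSimplex ℝ 0⟩ le_rfl
  refine ⟨w, hw, le_antisymm ?_ (gap_nonneg A hw)⟩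
  linarith [gap_le_infDist_dataSet (A := A) hw]

/-! ### The error bound constant -/

theorem inv_infDist_dataSet_le {A : Matrix (Fin m) (Fin n) ℝ} {κ : ℝ} (hκ : 0 ≤ κ)
    {w : Space m n} (hw : w ∈ simplexProd m n \ nashSet A)
    (h : Metric.infDist w (nashSet A) ≤ κ * gap A w) :
    (Metric.infDist 0 (dataSet A w))⁻¹ ≤ κ := by
  have hpos := gap_pos hw
  have hg : ∀ g ∈ dataSet A w, 1 ≤ ‖g‖ * κ := by
    intro g hg
    have hg0 : 0 < ‖g‖ := by linarith [gap_le_of_mem_dataSet hw.1 hg]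
    have h1 : gap A w / ‖g‖ ≤ Metric.infDist w (nashSet A) := by
      refine (Metric.le_infDist (nashSet_nonempty A)).2 fun z hz => ?_
      have h2 := gap_sub_gap_le_of_mem_dataSet hw.1 hg hz.1
      rw [hz.2, sub_zero] at h2
      exact (div_le_iff₀' hg0).2 h2
    have h3 := (div_le_iff₀' hg0).1 (h1.trans h)
    rw [← mul_assoc] at h3
    exact le_of_mul_le_mul_right (by rwa [one_mul]) hpos
  have hκ' : 0 < κ := by
    obtain ⟨g, hgm⟩ := dataSet_nonempty A w
    refine hκ.lt_of_ne fun h0 => ?_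
    have := hg g hgm
    rw [← h0] at this
    linarith
  refine inv_le_of_inv_le₀ hκ' ((Metric.le_infDist (dataSet_nonempty A w)).2 fun g hgm => ?_)
  rw [dist_zero_left, inv_le_iff_one_le_mul₀ hκ']
  exact hg g hgm

theorem infDist_nashSet_le {A : Matrix (Fin m) (Fin n) ℝ} {κ : ℝ} (hκ : 0 < κ)
    (h : ∀ w ∈ simplexProd m n \ nashSet A, (Metric.infDist 0 (dataSet A w))⁻¹ ≤ κ)
    {w₀ : Space m n} (hw₀ : w₀ ∈ simplexProd m n) :
    Metric.infDist w₀ (nashSet A) ≤ κ * gap A w₀ := by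
  by_contra! hlt
  have hd : 0 < Metric.infDist w₀ (nashSet A) :=
    (mul_nonneg hκ.le (gap_nonneg A hw₀)).trans_lt hlt
  -- With this slope, minimality keeps `w` closer to `w₀` than `S` is.
  obtain ⟨c, hc1, hc2⟩ : ∃ c, gap A w₀ / Metric.infDist w₀ (nashSet A) < c ∧ c < κ⁻¹ := by
    refine exists_between ?_
    rw [div_lt_iff₀ hd, inv_mul_eq_div, lt_div_iff₀ hκ]
    linarith
  have hc : 0 < c := (div_nonneg (gap_nonneg A hw₀) hd.le).trans_lt hc1
  obtain ⟨w, hw, hle, hG⟩ := exists_infDist_dataSet_le A hw₀ hc.le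
  have hnot : w ∉ nashSet A := by
    intro hS
    have h1 : Metric.infDist w₀ (nashSet A) ≤ dist w w₀ := by
      rw [dist_comm]; exact Metric.infDist_le_dist_of_mem hS
    rw [div_lt_iff₀ hd] at hc1
    linarith [mul_le_mul_of_nonneg_left h1 hc.le, gap_nonneg A hw]
  have h2 := inv_le_of_inv_le₀ (infDist_dataSet_pos ⟨hw, hnot⟩) (h w ⟨hw, hnot⟩)
  linarith

end Nonempty

/-- `G(w)` depends on `w` only through the finite index sets `I`, `K` and `J`. -/
theorem finite_range_dataSet (A : Matrix (Fin m) (Fin n) ℝ) : (Set.range (dataSet A)).Finite := by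
  let f : Set (Fin n) × Set (Fin m) × Set (Fin m ⊕ Fin n) → Set (Space m n) := fun q =>
    convexHull ℝ {v : Space m n | ∃ i ∈ q.1, ∃ k ∈ q.2.1,
      v = pair (colVec A i) (negRowVec A k)}
    + spanOnes m n
    - (PointedCone.hull ℝ (convexHull ℝ
        {v : Space m n | ∃ j ∈ q.2.2, v = EuclideanSpace.single j (1 : ℝ)}) :
        Set (Space m n))
  refine (Set.finite_range f).subset ?_
  rintro _ ⟨w, rfl⟩
  exact ⟨(activeCols A (xPart w), activeRows A (yPart w), zeroCoords w), rfl⟩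

theorem neZero_of_mem_stdSimplex {k : ℕ} {f : Fin k → ℝ} (hf : f ∈ stdSimplex ℝ (Fin k)) :
    NeZero k := by
  refine ⟨?_⟩
  rintro rfl
  simpa using hf.2

end MatrixGame

theorem theorem3 {m n : ℕ} (A : Matrix (Fin m) (Fin n) ℝ)
    (hne : (MatrixGame.simplexProd m n \ MatrixGame.nashSet A).Nonempty) :
    (∀ w ∈ MatrixGame.simplexProd m n \ MatrixGame.nashSet A,
      0 < Metric.infDist 0 (MatrixGame.dataSet A w)) ∧
    (∃ κ : ℝ, 0 ≤ κ ∧ ∀ w ∈ MatrixGame.simplexProd m n,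
      Metric.infDist w (MatrixGame.nashSet A) ≤ κ * MatrixGame.gap A w) ∧
    IsLUB ((fun w => (Metric.infDist 0 (MatrixGame.dataSet A w))⁻¹) ''
        (MatrixGame.simplexProd m n \ MatrixGame.nashSet A))
      (MatrixGame.conditionMeasure A) := by
  obtain ⟨w₁, hw₁⟩ := hne
  have : NeZero m := MatrixGame.neZero_of_mem_stdSimplex hw₁.1.1
  have : NeZero n := MatrixGame.neZero_of_mem_stdSimplex hw₁.1.2
  set T := (fun w => (Metric.infDist 0 (MatrixGame.dataSet A w))⁻¹) ''
    (MatrixGame.simplexProd m n \ MatrixGame.nashSet A) with hT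
  have hTne : T.Nonempty := ⟨_, w₁, hw₁, rfl⟩
  have hTbdd : BddAbove T := by
    refine Set.Finite.bddAbove (((MatrixGame.finite_range_dataSet A).image
      fun K => (Metric.infDist 0 K)⁻¹).subset ?_)
    rintro _ ⟨w, -, rfl⟩
    exact ⟨_, ⟨w, rfl⟩, rfl⟩
  have hset : {κ : ℝ | 0 ≤ κ ∧ ∀ w ∈ MatrixGame.simplexProd m n,
      Metric.infDist w (MatrixGame.nashSet A) ≤ κ * MatrixGame.gap A w} = upperBounds T := by
    ext κ
    constructor
    · rintro ⟨hκ, h⟩ _ ⟨w, hw, rfl⟩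
      exact MatrixGame.inv_infDist_dataSet_le hκ hw (h w hw.1)
    · intro h
      have hκ : 0 < κ := (inv_pos.2 (MatrixGame.infDist_dataSet_pos hw₁)).trans_le
        (h ⟨w₁, hw₁, rfl⟩)
      exact ⟨hκ.le, fun w hw => MatrixGame.infDist_nashSet_le hκ
        (fun z hz => h ⟨z, hz, rfl⟩) hw⟩
  refine ⟨fun w hw => MatrixGame.infDist_dataSet_pos hw, ?_, ?_⟩
  · obtain ⟨κ, hκ⟩ := hTbdd
    exact ⟨κ, hset.symm.subset hκ⟩
  · rw [MatrixGame.conditionMeasure, hset, csInf_upperBounds_eq_csSup hTbdd hTne]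
    exact isLUB_csSup hTne hTbdd
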